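/- Let $n,k\ge 0$ be integers and let $\lambda=(\lambda_1\ge\dots\ge\lambda_n\ge 0)$ be a partition of $k$ with at most $n$ parts. Let $s_\lambda(x_1,\dots,x_n)=\sum_T\prod_{x\in\lambda}x_{T(x)}$ be the Schur polynomial, the sum being over the semistandard Young tableaux $T$ of shape $\lambda$ with entries in $\{1,\dots,n\}$. Define the generalized Fibonacci polynomials $\{m\}_{s,t}\in\mathbb{Z}[s,t]$ by $\{0\}_{s,t}=0$, $\{1\}_{s,t}=1$, $\{m+2\}_{s,t}=s\{m+1\}_{s,t}+t\{m\}_{s,t}$. For a cell $x$ of $\lambda$ in row $i$ and column $j$ let $c(x)=j-i$, let $h(x)$ be the hook length (the number of cells in row $i$ weakly to the right of $x$ plus the number of cells in column $j$ strictly below $x$), and let $b(\lambda)=\sum_i(i-1)\lambda_i$. Then, for indeterminates $a,b$, $$s_\lambda(a^{n-1},a^{n-2}b,\dots,ab^{n-2},b^{n-1})=\left((-t)^{b(\lambda)}\prod_{x\in\lambda}\frac{\{n+c(x)\}_{s,t}}{\{h(x)\}_{s,t}}\right)_{s=a+b,\ t=-ab}.$$ Moreover, the rational function $(-t)^{b(\lambda)}\prod_{x\in\lambda}\{n+c(x)\}_{s,t}/\{h(x)\}_{s,t}$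 in the indeterminates $s,t$ is a polynomial in $\mathbb{Z}[s,t]$. -/

import Mathlib

/-- The generalized Fibonacci polynomials `{m}_{s,t}`, evaluated at elements `s`, `t` of a
commutative ring: `{0} = 0`, `{1} = 1`, `{m+2} = s {m+1} + t {m}`.  The polynomials themselves are
obtained by taking `s`, `t` to be indeterminates. -/
def genFib {R : Type*} [CommRing R] (s t : R) : ℕ → R
  | 0 => 0
  | 1 => 1
  | m + 2 => s * genFib s t (m + 1) + t * genFib s t m

/-- The content `j - i` of the cell in row `i` and column `j`. -/
def cellContent (x : ℕ × ℕ) : ℤ := (x.2 : ℤ) - (x.1 : ℤ)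

/-- The hook length at `x`: the number of cells of `lam` in the row of `x` and weakly to the right
of `x`, or in the column of `x` and strictly below `x`. -/
def hookLength (lam : YoungDiagram) (x : ℕ × ℕ) : ℕ :=
  (lam.cells.filter fun y => (y.1 = x.1 ∧ x.2 ≤ y.2) ∨ (y.2 = x.2 ∧ x.1 < y.1)).card

/-- `b(lam) = ∑ i, (i - 1) lam_i` for rows numbered from `1`; here rows are numbered from `0`. -/
def partitionB (lam : YoungDiagram) : ℕ :=
  ∑ i ∈ Finset.range (lam.colLen 0), i * lam.rowLen i

/-- Semistandard Young tableaux of shape `lam` with entries in `{0, …, n-1}`. -/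
def BoundedSSYT (n : ℕ) (lam : YoungDiagram) : Type :=
  {T : SemistandardYoungTableau lam // ∀ x ∈ lam.cells, T x.1 x.2 < n}

instance BoundedSSYT.instFinite (n : ℕ) (lam : YoungDiagram) : Finite (BoundedSSYT n lam) := by
  let f : BoundedSSYT n lam → (lam.cells → Fin n) :=
    fun T x => ⟨T.1 x.1.1 x.1.2, T.2 x.1 x.2⟩
  refine Finite.of_injective f fun T U h => Subtype.ext (SemistandardYoungTableau.ext fun i j => ?_)
  by_cases hij : (i, j) ∈ lam
  · exact congrArg Fin.val (congrFun h ⟨(i, j), hij⟩)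
  · rw [T.1.zeros hij, U.1.zeros hij]

noncomputable instance BoundedSSYT.instFintype (n : ℕ) (lam : YoungDiagram) :
    Fintype (BoundedSSYT n lam) :=
  Fintype.ofFinite _

/-- The Schur polynomial `s_lam(x_0, …, x_{n-1})`: the sum over the semistandard Young tableaux `T`
of shape `lam` with entries in `{0, …, n-1}` of the product of `x_{T(c)}` over the cells `c`. -/
noncomputable def schurPoly (n : ℕ) (lam : YoungDiagram) : MvPolynomial (Fin n) ℤ :=
  ∑ T : BoundedSSYT n lam,
    ∏ x : lam.cells, MvPolynomial.X ⟨T.1 x.1.1 x.1.2, T.2 x.1 x.2⟩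

/-- `(-t)^{b(lam)} ∏_{x ∈ lam} {n + c(x)}_{s,t} / {h(x)}_{s,t}` for `s`, `t` in a field.  If `lam`
has at most `n` rows, then `n + c(x) ≥ 1` for all cells `x`. -/
noncomputable def hookContentQuotient {K : Type*} [Field K] (n : ℕ) (lam : YoungDiagram)
    (s t : K) : K :=
  (-t) ^ partitionB lam *
    ∏ x ∈ lam.cells,
      genFib s t ((n : ℤ) + cellContent x).toNat / genFib s t (hookLength lam x)

/-- The specialization `s_lam(a^{n-1}, a^{n-2} b, …, a b^{n-2}, b^{n-1})`. -/
noncomputable def schurSpecialization {R : Type*} [CommRing R] (n : ℕ) (lam : YoungDiagram)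
    (a b : R) : R :=
  MvPolynomial.aeval (fun i : Fin n => a ^ (n - 1 - (i : ℕ)) * b ^ (i : ℕ)) (schurPoly n lam)

/-- The ring `ℤ[X_0, X_1]` of integer polynomials in two indeterminates. -/
abbrev IntPoly2 : Type := MvPolynomial (Fin 2) ℤ

/-- The field of rational functions in two indeterminates. -/
abbrev RatFun2 : Type := FractionRing IntPoly2

/-- The two indeterminates, as rational functions. -/
noncomputable def ratVar (i : Fin 2) : RatFun2 := algebraMap IntPoly2 RatFun2 (MvPolynomial.X i)

open Finset

/-! For `s = a + b`, `t = -ab` one has `{m} = (a^m - b^m)/(a - b)`, so a cell contributes `(a^{n+c}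
- b^{n+c})/(a^h - b^h)`. The Schur polynomial times `∏_{j<k} (x_j - x_k)` is the alternant `det
(x_j^{l_i})` with `l_i = lam_i + n - 1 - i` (`alternant_betaNumber`): both sides obey the same
recursion on the number of variables (`alternant_succ`, `schurEval_succ`). At `x_j = a^{n-1-j} b^j`
the alternant is a homogeneous Vandermonde determinant, a power of `ab` times the product of
`a^{l_i-l_k} - b^{l_i-l_k}` over `i < k` (`alternant_geometric_of_anti`). Its ratio to the case of
the empty partition becomes contents over hooks by `prod_hookContent`.

For polynomiality, the quotient depends only on `a + b` and `ab`, so the specialized Schur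
polynomial is symmetric in `a`, `b`, hence equal to `P(a + b, -ab)` with `P` integral. The
substitution is injective, so `P` is the quotient itself. -/

theorem genFib_mul_sub {R : Type*} [CommRing R] (a b : R) (m : ℕ) :
    genFib (a + b) (-(a * b)) m * (a - b) = a ^ m - b ^ m := by
  induction m using Nat.twoStepInduction with
  | zero => simp [genFib]
  | one => simp [genFib]
  | more m h1 h2 =>
    rw [genFib, add_mul, mul_assoc, mul_assoc, h1, h2]
    ring

theorem map_genFib {R S : Type*} [CommRing R] [CommRing S] (φ : R →+* S) (s t : R) (m : ℕ) :
    φ (genFib s t m) = genFib (φ s) (φ t) m := by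
  induction m using Nat.twoStepInduction with
  | zero => simp [genFib]
  | one => simp [genFib]
  | more m h1 h2 => simp [genFib, h1, h2]

/-! ### Hook lengths and contents, row by row. -/

namespace YoungDiagram

variable (lam : YoungDiagram)

theorem prod_cells {M : Type*} [CommMonoid M] {n : ℕ} (hn : lam.colLen 0 ≤ n)
    (g : ℕ × ℕ → M) :
    ∏ c ∈ lam.cells, g c = ∏ i ∈ range n, ∏ j ∈ range (lam.rowLen i), g (i, j) := by
  refine prod_finset_product _ _ _ fun c => ?_
  rw [mem_cells, mem_range, mem_range, ← mem_iff_lt_rowLen]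
  refine ⟨fun h => ⟨?_, h⟩, fun h => h.2⟩
  exact (mem_iff_lt_colLen.1 (lam.up_left_mem le_rfl (Nat.zero_le c.2) h)).trans_le hn

theorem rowLen_eq_zero {n : ℕ} (hn : lam.colLen 0 ≤ n) : lam.rowLen n = 0 := by
  by_contra h
  have := mem_iff_lt_colLen.1 (mem_iff_lt_rowLen.2 (Nat.pos_of_ne_zero h))
  omega

theorem hookLength_eq {i j : ℕ} (h : j < lam.rowLen i) :
    hookLength lam (i, j) = (lam.rowLen i - j) + (lam.colLen j - (i + 1)) := by
  have key : (lam.cells.filter fun y : ℕ × ℕ => (y.1 = i ∧ j ≤ y.2) ∨ (y.2 = j ∧ i < y.1)) =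
      ({i} ×ˢ Ico j (lam.rowLen i)) ∪ (Ico (i + 1) (lam.colLen j) ×ˢ {j}) := by
    ext ⟨u, v⟩
    simp only [mem_filter, mem_cells, mem_union, mem_product, mem_singleton, mem_Ico]
    constructor
    · rintro ⟨hm, ⟨rfl, hv⟩ | ⟨rfl, hu⟩⟩
      · exact Or.inl ⟨rfl, hv, mem_iff_lt_rowLen.1 hm⟩
      · exact Or.inr ⟨⟨hu, mem_iff_lt_colLen.1 hm⟩, rfl⟩
    · rintro (⟨rfl, hv, hm⟩ | ⟨⟨hu, hm⟩, rfl⟩)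
      · exact ⟨mem_iff_lt_rowLen.2 hm, Or.inl ⟨rfl, hv⟩⟩
      · exact ⟨mem_iff_lt_colLen.2 hm, Or.inr ⟨rfl, hu⟩⟩
  rw [hookLength, key, card_union_of_disjoint]
  · simp
  · rw [disjoint_left]
    rintro ⟨u, v⟩ h1 h2
    simp only [mem_product, mem_singleton, mem_Ico] at h1 h2
    omega

/-- The exponents `lam_i + n - 1 - i` (rows numbered from `0`) of the alternant of `lam`. -/
def betaNumber (n i : ℕ) : ℕ := lam.rowLen i + (n - 1 - i)

theorem betaNumber_lt {n i k : ℕ} (hik : i < k) (hk : k < n) :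
    lam.betaNumber n k < lam.betaNumber n i := by
  have := lam.rowLen_anti i k hik.le
  unfold betaNumber
  omega

/-- The hook lengths in row `i` and the differences `l_i - l_k`, `k > i`, together list each of `1,
…, l_i` exactly once: they are distinct, lie in this range, and number `lam_i + (n - 1 - i) = l_i`.
-/
theorem prod_hookLength_row {M : Type*} [CommMonoid M] (f : ℕ → M) {n i : ℕ}
    (hn : lam.colLen 0 ≤ n) (hi : i < n) :
    (∏ j ∈ range (lam.rowLen i), f (hookLength lam (i, j))) *
        ∏ k ∈ Ioo i n, f (lam.betaNumber n i - lam.betaNumber n k) =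
      ∏ m ∈ range (lam.betaNumber n i), f (m + 1) := by
  have hcol : ∀ j, lam.colLen j ≤ n := fun j => (lam.colLen_anti 0 j (Nat.zero_le j)).trans hn
  have hmem : ∀ {k j}, j < lam.rowLen k ↔ k < lam.colLen j := fun {k j} => by
    rw [← mem_iff_lt_rowLen, mem_iff_lt_colLen]
  have inj1 : Set.InjOn (fun j => hookLength lam (i, j)) (range (lam.rowLen i)) := by
    intro j hj j' hj' h
    simp only [coe_range, Set.mem_Iio] at hj hj'
    simp only [lam.hookLength_eq hj, lam.hookLength_eq hj'] at h
    rcases le_total j j' with hh | hh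
    · have := lam.colLen_anti _ _ hh
      omega
    · have := lam.colLen_anti _ _ hh
      omega
  have inj2 : Set.InjOn (fun k => lam.betaNumber n i - lam.betaNumber n k) (Ioo i n) := by
    intro k hk k' hk' h
    simp only [coe_Ioo, Set.mem_Ioo] at hk hk' h
    have h1 := lam.betaNumber_lt hk.1 hk.2
    have h2 := lam.betaNumber_lt hk'.1 hk'.2
    rcases lt_trichotomy k k' with hh | hh | hh
    · have := lam.betaNumber_lt hh hk'.2
      omega
    · exact hh
    · have := lam.betaNumber_lt hh hk.2
      omega
  have disj : Disjoint ((range (lam.rowLen i)).image fun j => hookLength lam (i, j))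
      ((Ioo i n).image fun k => lam.betaNumber n i - lam.betaNumber n k) := by
    rw [disjoint_left]
    intro v h1 h2
    obtain ⟨j, hj, rfl⟩ := mem_image.1 h1
    obtain ⟨k, hk, h⟩ := mem_image.1 h2
    rw [mem_range] at hj
    rw [mem_Ioo] at hk
    have hlt := lam.betaNumber_lt hk.1 hk.2
    have hij := hmem.1 hj
    rw [lam.hookLength_eq hj] at h
    unfold betaNumber at h hlt
    -- The hook length at `(i, j)` exceeds `l_i - l_k` if column `j` reaches row `k`, and is smaller
    -- otherwise.
    by_cases hjk : j < lam.rowLen k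
    · have := hmem.1 hjk
      omega
    · have := mt hmem.2 hjk
      omega
  have hunion : ((range (lam.rowLen i)).image fun j => hookLength lam (i, j)) ∪
      ((Ioo i n).image fun k => lam.betaNumber n i - lam.betaNumber n k) =
      (range (lam.betaNumber n i)).image (· + 1) := by
    refine eq_of_subset_of_card_le ?_ ?_
    · refine union_subset ?_ ?_ <;> intro v hv
      · obtain ⟨j, hj, rfl⟩ := mem_image.1 hv
        rw [mem_range] at hj
        refine mem_image.2 ⟨hookLength lam (i, j) - 1, mem_range.2 ?_, ?_⟩ <;>
        · simp only [lam.hookLength_eq hj, betaNumber]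
          have := hcol j
          omega
      · obtain ⟨k, hk, rfl⟩ := mem_image.1 hv
        rw [mem_Ioo] at hk
        have hlt := lam.betaNumber_lt hk.1 hk.2
        refine mem_image.2 ⟨lam.betaNumber n i - lam.betaNumber n k - 1, mem_range.2 ?_, ?_⟩ <;>
          omega
    · rw [card_union_of_disjoint disj, card_image_of_injOn inj1, card_image_of_injOn inj2,
        card_image_of_injective _ (add_left_injective 1)]
      simp only [card_range, Nat.card_Ioo, betaNumber]
      omega
  rw [← prod_image (g := fun j => hookLength lam (i, j)) (f := f) inj1,
    ← prod_image (g := fun k => lam.betaNumber n i - lam.betaNumber n k) (f := f) inj2,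
    ← prod_union disj, hunion, prod_image (fun _ _ _ _ h => Nat.succ_injective h)]

/-- The values `n + c` in row `i` are the consecutive integers `n - i, …, l_i`, and the `k - i`
supply the missing `1, …, n - 1 - i`. -/
theorem prod_content_row {M : Type*} [CommMonoid M] (f : ℕ → M) {n i : ℕ} (hi : i < n) :
    (∏ j ∈ range (lam.rowLen i), f ((n : ℤ) + cellContent (i, j)).toNat) *
        ∏ k ∈ Ioo i n, f (k - i) =
      ∏ m ∈ range (lam.betaNumber n i), f (m + 1) := by
  have h1 : ∏ k ∈ Ioo i n, f (k - i) = ∏ m ∈ range (n - 1 - i), f (m + 1) := by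
    have : Ioo i n = Ico (i + 1) n := by ext; simp only [mem_Ioo, mem_Ico]; omega
    rw [this, prod_Ico_eq_prod_range]
    refine prod_congr (congrArg range (by omega)) fun m _ => ?_
    congr 1
    omega
  rw [h1, betaNumber, add_comm (lam.rowLen i), prod_range_add, mul_comm]
  congr 1
  refine prod_congr rfl fun j _ => ?_
  congr 1
  simp only [cellContent]
  omega

/-- In each row the hook and content identities have the same right-hand side, so the hooks cancel.
-/
theorem prod_hookContent {K : Type*} [Field K] (f : ℕ → K) (hf : ∀ m, 0 < m → f m ≠ 0) {n : ℕ}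
    (hn : lam.colLen 0 ≤ n) :
    (∏ c ∈ lam.cells, f ((n : ℤ) + cellContent c).toNat / f (hookLength lam c)) *
        ∏ i ∈ range n, ∏ k ∈ Ioo i n, f (k - i) =
      ∏ i ∈ range n, ∏ k ∈ Ioo i n, f (lam.betaNumber n i - lam.betaNumber n k) := by
  rw [lam.prod_cells hn, ← prod_mul_distrib]
  refine prod_congr rfl fun i hi => ?_
  rw [mem_range] at hi
  have hh : ∏ j ∈ range (lam.rowLen i), f (hookLength lam (i, j)) ≠ 0 := by
    refine prod_ne_zero_iff.2 fun j hj => hf _ ?_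
    rw [mem_range] at hj
    rw [lam.hookLength_eq hj]
    omega
  rw [prod_div_distrib, div_mul_eq_mul_div, lam.prod_content_row f hi,
    ← lam.prod_hookLength_row f hn hi, mul_div_cancel_left₀ _ hh]

end YoungDiagram

/-- The alternant `det (x_j ^ l_i)` in the variables `x_0, …, x_{n-1}`. -/
def alternant {R : Type*} [CommRing R] (x : ℕ → R) {n : ℕ} (l : Fin n → ℕ) : R :=
  (Matrix.of fun i j : Fin n => x j ^ l i).det

/-! ### Alternants: recursion on the number of variables, and geometric specialization. -/

section Alternant

variable {R : Type*} [CommRing R] (x : ℕ → R)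

theorem alternant_eq_det_sub {n : ℕ} (l : Fin (n + 1) → ℕ)
    (hl : ∀ i : Fin n, l i.succ ≤ l i.castSucc) :
    alternant x l = x n ^ l (Fin.last n) * (Matrix.of fun i j : Fin n =>
      x j ^ l i.castSucc - x j ^ l i.succ * x n ^ (l i.castSucc - l i.succ)).det := by
  -- Reversing rows and columns together preserves the determinant. It turns "subtract a multiple of
  -- the next row" into "subtract a multiple of the preceding row", and the last column, which is to
  -- be cleared, into column `0`.
  set A : Matrix (Fin (n + 1)) (Fin (n + 1)) R :=
    (Matrix.of fun i j : Fin (n + 1) => x j ^ l i).submatrix Fin.rev Fin.rev with hA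
  let c : Fin n → R := fun i => x n ^ (l i.rev.castSucc - l i.rev.succ)
  let B : Matrix (Fin (n + 1)) (Fin (n + 1)) R := Matrix.of fun i j =>
    Fin.cases (A 0 j) (fun i => A i.succ j - c i * A i.castSucc j) i
  have h1 : alternant x l = A.det :=
    (Matrix.det_submatrix_equiv_self Fin.revPerm _).symm
  have h2 : A.det = B.det :=
    Matrix.det_eq_of_forall_row_eq_smul_add_pred c (fun j => rfl) fun i j => by simp [B]
  have h3 : B.submatrix Fin.succ Fin.succ = (Matrix.of fun i j : Fin n =>
      x j ^ l i.castSucc - x j ^ l i.succ * x n ^ (l i.castSucc - l i.succ)).submatrix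
        Fin.revPerm Fin.revPerm := by
    ext i j
    simp only [B, hA, c, Matrix.submatrix_apply, Matrix.of_apply, Fin.cases_succ, Fin.rev_succ,
      Fin.rev_castSucc, Fin.revPerm_apply, Fin.val_castSucc]
    ring
  rw [h1, h2, Matrix.det_succ_column_zero, Fin.sum_univ_succ, sum_eq_zero, add_zero]
  · rw [show B.submatrix (Fin.succAbove 0) Fin.succ = B.submatrix Fin.succ Fin.succ by
      rw [Fin.succAbove_zero], h3, Matrix.det_submatrix_equiv_self]
    simp [B, hA]
  · intro i _
    have : B i.succ 0 = 0 := by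
      simp only [B, hA, c, Matrix.submatrix_apply, Matrix.of_apply, Fin.cases_succ, Fin.rev_succ,
        Fin.rev_castSucc, Fin.rev_zero, Fin.val_last]
      rw [← pow_add, Nat.sub_add_cancel (hl _), sub_self]
    rw [this, mul_zero, zero_mul]

/-- Column `j` of the reduced determinant is divisible by `x j - x n`, with geometric sums as
quotients; multilinearity in the rows then picks one exponent `m i` from each sum. -/
theorem alternant_succ {n : ℕ} (l : Fin (n + 1) → ℕ)
    (hl : ∀ i : Fin n, l i.succ ≤ l i.castSucc) :
    alternant x l = (∏ j : Fin n, (x j - x n)) *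
      ∑ m ∈ Fintype.piFinset fun i : Fin n => Ico (l i.succ) (l i.castSucc),
        x n ^ l (Fin.last n) * (∏ i : Fin n, x n ^ (l i.castSucc - 1 - m i)) * alternant x m := by
  have h1 : (Matrix.of fun i j : Fin n =>
      x j ^ l i.castSucc - x j ^ l i.succ * x n ^ (l i.castSucc - l i.succ)) =
      Matrix.of fun i j : Fin n => (x j - x n) * (Matrix.of fun i j : Fin n =>
        ∑ m ∈ Ico (l i.succ) (l i.castSucc), x j ^ m * x n ^ (l i.castSucc - 1 - m)) i j := by
    ext i j
    simp only [Matrix.of_apply]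
    rw [mul_geom_sum₂_Ico _ _ (hl i)]
  have h2 : (Matrix.of fun i j : Fin n =>
      ∑ m ∈ Ico (l i.succ) (l i.castSucc), x j ^ m * x n ^ (l i.castSucc - 1 - m)).det =
      ∑ m ∈ Fintype.piFinset fun i : Fin n => Ico (l i.succ) (l i.castSucc),
        (∏ i : Fin n, x n ^ (l i.castSucc - 1 - m i)) * alternant x m := by
    have h := (Matrix.detRowAlternating (n := Fin n) (R := R)).toMultilinearMap.map_sum_finset
      (fun (i : Fin n) (m : ℕ) (j : Fin n) => x j ^ m * x n ^ (l i.castSucc - 1 - m))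
      (fun i => Ico (l i.succ) (l i.castSucc))
    refine Eq.trans ?_ (h.trans (sum_congr rfl fun m _ => ?_))
    · refine congrArg Matrix.det ?_
      ext i j
      simp [Finset.sum_apply]
    · rw [alternant, ← Matrix.det_mul_column]
      refine congrArg Matrix.det ?_
      ext i j
      simp [mul_comm]
  rw [alternant_eq_det_sub x l hl, h1, Matrix.det_mul_row, h2, mul_left_comm, mul_sum]
  simp only [mul_assoc]

/-- The entry `x_j^{l_i}` equals `(a^{l_i})^{n-1-j} (b^{l_i})^j`, a projective Vandermonde entry. -/
theorem alternant_geometric {n : ℕ} (a b : R) (l : Fin n → ℕ) :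
    alternant (fun j => a ^ (n - 1 - j) * b ^ j) l =
      ∏ i : Fin n, ∏ k ∈ Ioi i, (b ^ l k * a ^ l i - b ^ l i * a ^ l k) := by
  rw [← Matrix.det_projVandermonde, alternant]
  congr 1
  ext i j
  rw [Matrix.projVandermonde_apply, Matrix.of_apply, Fin.val_rev, mul_pow, ← pow_mul, ← pow_mul,
    ← pow_mul, ← pow_mul, mul_comm, mul_comm (l i), mul_comm (l i)]
  congr 3
  omega

theorem alternant_geometric_of_anti {n : ℕ} (a b : R) (l : ℕ → ℕ)
    (hl : ∀ i k, i < k → k < n → l k ≤ l i) :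
    alternant (fun j => a ^ (n - 1 - j) * b ^ j) (fun i : Fin n => l i) =
      (a * b) ^ (∑ k ∈ range n, k * l k) *
        ∏ i ∈ range n, ∏ k ∈ Ioo i n, (a ^ (l i - l k) - b ^ (l i - l k)) := by
  -- The factor of a pair `i < k` yields `(a * b) ^ l k`, and each `k` has `k` such partners `i`.
  have h1 : (a * b) ^ (∑ k ∈ range n, k * l k) =
      ∏ i ∈ range n, ∏ k ∈ Ioo i n, (a * b) ^ l k := by
    rw [← prod_pow_eq_pow_sum, prod_comm' (t' := range n) (s' := fun k => range k)]
    · refine prod_congr rfl fun k _ => ?_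
      rw [prod_const, card_range, ← pow_mul, mul_comm k]
    · intro i k
      simp only [mem_range, mem_Ioo]
      omega
  rw [alternant_geometric, h1, ← prod_mul_distrib, ← Fin.prod_univ_eq_prod_range]
  refine prod_congr rfl fun i _ => ?_
  rw [← prod_mul_distrib, ← Fin.map_valEmbedding_Ioi, prod_map]
  refine prod_congr rfl fun k hk => ?_
  have := hl i k (Fin.lt_def.1 (mem_Ioi.1 hk)) k.2
  obtain ⟨d, hd⟩ := Nat.exists_eq_add_of_le this
  simp only [Fin.valEmbedding_apply, hd, Nat.add_sub_cancel_left]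
  ring

end Alternant

/-! ### Branching of tableaux: removing the largest entry. -/

/-- The Schur polynomial of `lam` in `n` variables, evaluated at `x_0, …, x_{n-1}`. -/
noncomputable def schurEval {R : Type*} [CommRing R] (x : ℕ → R) (n : ℕ) (lam : YoungDiagram) : R :=
  ∑ T : BoundedSSYT n lam, ∏ c ∈ lam.cells, x (T.1 c.1 c.2)

/-- The Young diagram with rows of lengths `m_0 ≥ m_1 ≥ …`. -/
def YoungDiagram.ofRows {n : ℕ} (m : Fin n → ℕ) : YoungDiagram where
  -- Testing all rows `i ≤ c.1` gives a lower set even if `m` is not antitone. The width `∑ i, m i`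
  -- only ensures finiteness.
  cells := (range n ×ˢ range (∑ i, m i)).filter fun c => ∀ i : Fin n, (i : ℕ) ≤ c.1 → c.2 < m i
  isLowerSet := by
    rintro ⟨i, j⟩ ⟨i', j'⟩ ⟨hi, hj⟩ h
    simp only [coe_filter, mem_product, mem_range, Set.mem_ofPred_eq] at h hi hj ⊢
    exact ⟨⟨hi.trans_lt h.1.1, hj.trans_lt h.1.2⟩,
      fun k hk => hj.trans_lt (h.2 k (hk.trans hi))⟩

namespace YoungDiagram

/-- The sequences `m` with `lam_0 ≥ m_0 ≥ lam_1 ≥ m_1 ≥ …`. -/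
def interlacing (n : ℕ) (lam : YoungDiagram) : Finset (Fin n → ℕ) :=
  Fintype.piFinset fun i : Fin n => Icc (lam.rowLen (i + 1)) (lam.rowLen i)

variable {n : ℕ} {lam : YoungDiagram} {m : Fin n → ℕ}

theorem mem_interlacing :
    m ∈ lam.interlacing n ↔ ∀ i : Fin n, lam.rowLen (i + 1) ≤ m i ∧ m i ≤ lam.rowLen i := by
  simp [interlacing]

theorem antitone_of_mem_interlacing (hm : m ∈ lam.interlacing n) {i k : Fin n} (h : i ≤ k) :
    m k ≤ m i := by
  rcases h.eq_or_lt with rfl | h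
  · exact le_rfl
  · rw [mem_interlacing] at hm
    exact (hm k).2.trans ((lam.rowLen_anti (i + 1) k h).trans (hm i).1)

theorem mem_ofRows (hm : m ∈ lam.interlacing n) {i j : ℕ} :
    (i, j) ∈ ofRows m ↔ ∃ h : i < n, j < m ⟨i, h⟩ := by
  rw [← mem_cells]
  simp only [ofRows, mem_filter, mem_product, mem_range]
  constructor
  · rintro ⟨⟨h, _⟩, h'⟩
    exact ⟨h, h' ⟨i, h⟩ le_rfl⟩
  · rintro ⟨h, h'⟩
    exact ⟨⟨h, h'.trans_le (single_le_sum (f := m) (fun _ _ => Nat.zero_le _) (mem_univ _))⟩,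
      fun k hk => h'.trans_le (antitone_of_mem_interlacing hm (Fin.le_def.2 hk))⟩

theorem rowLen_ofRows (hm : m ∈ lam.interlacing n) (i : Fin n) : (ofRows m).rowLen i = m i := by
  refine eq_of_forall_lt_iff fun j => ?_
  rw [← mem_iff_lt_rowLen, mem_ofRows hm]
  simp

theorem colLen_ofRows (hm : m ∈ lam.interlacing n) : (ofRows m).colLen 0 ≤ n := by
  by_contra! h
  obtain ⟨h, _⟩ := (mem_ofRows hm).1 (mem_iff_lt_colLen.2 h)
  exact lt_irrefl _ h

theorem ofRows_le (hm : m ∈ lam.interlacing n) {i j : ℕ} (h : (i, j) ∈ ofRows m) : (i, j) ∈ lam := by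
  obtain ⟨hi, hj⟩ := (mem_ofRows hm).1 h
  exact mem_iff_lt_rowLen.2 (hj.trans_le (mem_interlacing.1 hm ⟨i, hi⟩).2)

/-- Interlacing means that the removed cells form a horizontal strip, at most one per column. This
makes columns strict when the strip is filled with `n`. -/
theorem mem_ofRows_of_succ_mem (hm : m ∈ lam.interlacing n) (hn : lam.colLen 0 ≤ n + 1)
    {i k j : ℕ} (hik : i < k) (h : (k, j) ∈ lam) : (i, j) ∈ ofRows m := by
  have hk : k < lam.colLen 0 := mem_iff_lt_colLen.1 (lam.up_left_mem le_rfl (Nat.zero_le j) h)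
  have hi : i < n := by omega
  refine (mem_ofRows hm).2 ⟨hi, ?_⟩
  exact (mem_iff_lt_rowLen.1 (lam.up_left_mem (Nat.succ_le_of_lt hik) le_rfl h)).trans_le
    (mem_interlacing.1 hm ⟨i, hi⟩).1

end YoungDiagram

namespace SemistandardYoungTableau

variable {lam : YoungDiagram}

/-- This confines entries smaller than `n` to the first `n` rows. -/
theorem le_entry (T : SemistandardYoungTableau lam) {i j : ℕ} (h : (i, j) ∈ lam) : i ≤ T i j := by
  induction i with
  | zero => exact Nat.zero_le _
  | succ i ih =>
    have := ih (lam.up_left_mem (Nat.le_succ i) le_rfl h)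
    have := T.col_strict (lt_add_one i) h
    omega

/-- The cells of a tableau with entries smaller than `n`. -/
def sublevel (T : SemistandardYoungTableau lam) (n : ℕ) : YoungDiagram where
  cells := lam.cells.filter fun c => T c.1 c.2 < n
  isLowerSet := by
    rintro ⟨i, j⟩ ⟨i', j'⟩ ⟨hi, hj⟩ h
    simp only [coe_filter, YoungDiagram.mem_cells, Set.mem_ofPred_eq] at h hi hj ⊢
    refine ⟨lam.up_left_mem hi hj h.1, ?_⟩
    exact ((T.row_weak_of_le hj (lam.up_left_mem hi le_rfl h.1)).trans
      (T.col_weak hi h.1)).trans_lt h.2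

theorem lt_rowLen_sublevel (T : SemistandardYoungTableau lam) {n i j : ℕ} :
    j < (T.sublevel n).rowLen i ↔ (i, j) ∈ lam ∧ T i j < n := by
  rw [← YoungDiagram.mem_iff_lt_rowLen, ← YoungDiagram.mem_cells]
  simp [sublevel]

/-- The restriction of a tableau to a smaller shape. -/
def restrict (T : SemistandardYoungTableau lam) (mu : YoungDiagram)
    (hmu : ∀ i j, (i, j) ∈ mu → (i, j) ∈ lam) : SemistandardYoungTableau mu where
  entry i j := if (i, j) ∈ mu then T i j else 0
  row_weak' {i j1 j2} hj h := by
    rw [if_pos h, if_pos (mu.up_left_mem le_rfl hj.le h)]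
    exact T.row_weak hj (hmu _ _ h)
  col_strict' {i1 i2 j} hi h := by
    rw [if_pos h, if_pos (mu.up_left_mem hi.le le_rfl h)]
    exact T.col_strict hi (hmu _ _ h)
  zeros' h := if_neg h

theorem restrict_apply (T : SemistandardYoungTableau lam) (mu : YoungDiagram)
    (hmu : ∀ i j, (i, j) ∈ mu → (i, j) ∈ lam) (i j : ℕ) :
    T.restrict mu hmu i j = if (i, j) ∈ mu then T i j else 0 := rfl

end SemistandardYoungTableau

namespace BoundedSSYT

open YoungDiagram

variable {n : ℕ} {lam : YoungDiagram} {m : Fin n → ℕ}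

/-- The lengths of the rows of the diagram of the cells with entries smaller than `n`. -/
def lowerRows (T : BoundedSSYT (n + 1) lam) : Fin n → ℕ := fun i => (T.1.sublevel n).rowLen i

theorem lowerRows_mem (T : BoundedSSYT (n + 1) lam) : T.lowerRows ∈ lam.interlacing n := by
  rw [mem_interlacing]
  refine fun i => ⟨?_, ?_⟩
  · refine le_of_forall_lt fun j hj => ?_
    have hj' := mem_iff_lt_rowLen.2 hj
    refine T.1.lt_rowLen_sublevel.2 ⟨lam.up_left_mem (Nat.le_succ _) le_rfl hj', ?_⟩
    have h1 := T.1.col_strict (lt_add_one (i : ℕ)) hj'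
    have h2 := T.2 _ hj'
    simp only at h2
    omega
  · refine le_of_forall_lt fun j hj => ?_
    exact mem_iff_lt_rowLen.1 (T.1.lt_rowLen_sublevel.1 hj).1

theorem mem_ofRows_lowerRows (T : BoundedSSYT (n + 1) lam) {i j : ℕ} :
    (i, j) ∈ ofRows T.lowerRows ↔ (i, j) ∈ lam ∧ T.1 i j < n := by
  rw [mem_ofRows T.lowerRows_mem, ← T.1.lt_rowLen_sublevel]
  refine ⟨fun ⟨_, h⟩ => h, fun h => ⟨?_, h⟩⟩
  obtain ⟨h1, h2⟩ := T.1.lt_rowLen_sublevel.1 h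
  exact (T.1.le_entry h1).trans_lt h2

theorem eq_of_notMem_ofRows (T : BoundedSSYT (n + 1) lam) {i j : ℕ} (h : (i, j) ∈ lam)
    (h' : (i, j) ∉ ofRows T.lowerRows) : T.1 i j = n := by
  rw [mem_ofRows_lowerRows] at h'
  have h1 := T.2 _ h
  simp only at h1
  have h2 : ¬ T.1 i j < n := fun h2 => h' ⟨h, h2⟩
  omega

/-- Removal of the cells with the largest entry. -/
def lower (hm : m ∈ lam.interlacing n) (T : BoundedSSYT (n + 1) lam) (hT : T.lowerRows = m) :
    BoundedSSYT n (ofRows m) :=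
  ⟨T.1.restrict (ofRows m) fun _ _ => ofRows_le hm, by
    rintro ⟨i, j⟩ h
    rw [mem_cells] at h
    rw [SemistandardYoungTableau.restrict_apply, if_pos h]
    rw [← hT] at h
    exact (T.mem_ofRows_lowerRows.1 h).2⟩

/-- Addition of cells with the largest entry. -/
def raise (hm : m ∈ lam.interlacing n) (hn : lam.colLen 0 ≤ n + 1) (U : BoundedSSYT n (ofRows m)) :
    BoundedSSYT (n + 1) lam :=
  ⟨{ entry := fun i j => if (i, j) ∈ ofRows m then U.1 i j else if (i, j) ∈ lam then n else 0
     row_weak' := fun {i j1 j2} hj h => by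
      have h1 := lam.up_left_mem le_rfl hj.le h
      by_cases h2 : (i, j2) ∈ ofRows m
      · rw [if_pos h2, if_pos ((ofRows m).up_left_mem le_rfl hj.le h2)]
        exact U.1.row_weak hj h2
      · rw [if_neg h2, if_pos h]
        split_ifs with h3
        · exact (U.2 _ h3).le
        · exact le_rfl
     col_strict' := fun {i1 i2 j} hi h => by
      have h1 := mem_ofRows_of_succ_mem hm hn hi h
      rw [if_pos h1]
      split_ifs with h2
      · exact U.1.col_strict hi h2
      · exact U.2 _ h1
     zeros' := fun {i j} h => by
      rw [if_neg (mt (ofRows_le hm) h), if_neg h] }, by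
    rintro ⟨i, j⟩ h
    change (if (i, j) ∈ ofRows m then U.1 i j else if (i, j) ∈ lam then n else 0) < n + 1
    split_ifs with h1 h2
    · exact (U.2 _ h1).trans (Nat.lt_succ_self n)
    · exact Nat.lt_succ_self n
    · exact Nat.succ_pos n⟩

theorem raise_apply (hm : m ∈ lam.interlacing n) (hn : lam.colLen 0 ≤ n + 1)
    (U : BoundedSSYT n (ofRows m)) (i j : ℕ) :
    (raise hm hn U).1 i j =
      if (i, j) ∈ ofRows m then U.1 i j else if (i, j) ∈ lam then n else 0 := rfl

theorem lower_apply (hm : m ∈ lam.interlacing n) (T : BoundedSSYT (n + 1) lam)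
    (hT : T.lowerRows = m) (i j : ℕ) :
    (lower hm T hT).1 i j = if (i, j) ∈ ofRows m then T.1 i j else 0 := rfl

theorem lowerRows_raise (hm : m ∈ lam.interlacing n) (hn : lam.colLen 0 ≤ n + 1)
    (U : BoundedSSYT n (ofRows m)) : (raise hm hn U).lowerRows = m := by
  funext i
  refine eq_of_forall_lt_iff fun j => ?_
  rw [lowerRows, SemistandardYoungTableau.lt_rowLen_sublevel, raise_apply]
  have key : (↑i, j) ∈ ofRows m ↔ j < m i := by
    rw [mem_ofRows hm]
    simp
  rw [← key]
  constructor
  · rintro ⟨h1, h2⟩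
    by_contra h
    rw [if_neg h, if_pos h1] at h2
    exact lt_irrefl _ h2
  · intro h
    rw [if_pos h]
    exact ⟨ofRows_le hm h, U.2 _ h⟩

theorem lower_raise (hm : m ∈ lam.interlacing n) (hn : lam.colLen 0 ≤ n + 1)
    (U : BoundedSSYT n (ofRows m)) :
    lower hm (raise hm hn U) (lowerRows_raise hm hn U) = U := by
  refine Subtype.ext (SemistandardYoungTableau.ext fun i j => ?_)
  rw [lower_apply, raise_apply]
  split_ifs with h
  · rfl
  · exact (U.1.zeros h).symm

theorem raise_lower (hm : m ∈ lam.interlacing n) (hn : lam.colLen 0 ≤ n + 1)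
    (T : BoundedSSYT (n + 1) lam) (hT : T.lowerRows = m) :
    raise hm hn (lower hm T hT) = T := by
  refine Subtype.ext (SemistandardYoungTableau.ext fun i j => ?_)
  rw [raise_apply, lower_apply]
  split_ifs with h h'
  · rfl
  · subst hT
    exact (T.eq_of_notMem_ofRows h' h).symm
  · exact (T.1.zeros h').symm

theorem prod_raise {R : Type*} [CommRing R] (x : ℕ → R) (hm : m ∈ lam.interlacing n)
    (hn : lam.colLen 0 ≤ n + 1) (U : BoundedSSYT n (ofRows m)) :
    ∏ c ∈ lam.cells, x ((raise hm hn U).1 c.1 c.2) =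
      x n ^ lam.rowLen n * (∏ i : Fin n, x n ^ (lam.rowLen i - m i)) *
        ∏ c ∈ (ofRows m).cells, x (U.1 c.1 c.2) := by
  have hlast : ∏ j ∈ range (lam.rowLen n), x ((raise hm hn U).1 n j) = x n ^ lam.rowLen n := by
    rw [prod_congr rfl (g := fun _ => x n), prod_const, card_range]
    intro j hj
    rw [raise_apply, if_neg, if_pos (mem_iff_lt_rowLen.2 (mem_range.1 hj))]
    rw [mem_ofRows hm]
    exact fun ⟨h, _⟩ => lt_irrefl _ h
  rw [lam.prod_cells hn, prod_range_succ, hlast, (ofRows m).prod_cells (colLen_ofRows hm),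
    mul_comm, mul_assoc, ← Fin.prod_univ_eq_prod_range, ← Fin.prod_univ_eq_prod_range,
    ← prod_mul_distrib]
  congr 1
  refine prod_congr rfl fun i _ => ?_
  have hmi := (mem_interlacing.1 hm i).2
  have key : ∀ {j}, (↑i, j) ∈ ofRows m ↔ j < m i := fun {j} => by
    rw [mem_ofRows hm]
    simp
  rw [rowLen_ofRows hm, ← prod_range_mul_prod_Ico _ hmi, mul_comm]
  congr 1
  · rw [prod_congr rfl (g := fun _ => x n), prod_const, Nat.card_Ico]
    intro j hj
    rw [mem_Ico] at hj
    rw [raise_apply, if_neg (mt key.1 hj.1.not_gt), if_pos (mem_iff_lt_rowLen.2 hj.2)]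
  · refine prod_congr rfl fun j hj => ?_
    rw [raise_apply, if_pos (key.2 (mem_range.1 hj))]

end BoundedSSYT

open YoungDiagram in
-- Tableaux are grouped by the shape `m` of their entries smaller than `n`; `raise` and `lower`
-- identify each group with the tableaux of shape `m`, and the strip contributes powers of `x n`.
theorem schurEval_succ {R : Type*} [CommRing R] (x : ℕ → R) {n : ℕ} {lam : YoungDiagram}
    (hn : lam.colLen 0 ≤ n + 1) :
    schurEval x (n + 1) lam = ∑ m ∈ lam.interlacing n,
      x n ^ lam.rowLen n * (∏ i : Fin n, x n ^ (lam.rowLen i - m i)) *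
        schurEval x n (ofRows m) := by
  classical
  rw [schurEval, ← sum_fiberwise_of_maps_to (t := lam.interlacing n) (g := BoundedSSYT.lowerRows)
    fun T _ => T.lowerRows_mem]
  refine sum_congr rfl fun m hm => ?_
  rw [schurEval, mul_sum]
  symm
  refine sum_bij' (fun U _ => BoundedSSYT.raise hm hn U)
    (fun T hT => BoundedSSYT.lower hm T (mem_filter.1 hT).2) ?_ ?_ ?_ ?_ ?_
  · exact fun U _ => mem_filter.2 ⟨mem_univ _, BoundedSSYT.lowerRows_raise hm hn U⟩
  · exact fun T _ => mem_univ _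
  · exact fun U _ => BoundedSSYT.lower_raise hm hn U
  · exact fun T hT => BoundedSSYT.raise_lower hm hn T (mem_filter.1 hT).2
  · exact fun U _ => (BoundedSSYT.prod_raise x hm hn U).symm

/-! ### The bialternant formula. -/

section Bialternant

variable {R : Type*} [CommRing R]

theorem schurEval_eq_one (x : ℕ → R) (n : ℕ) {lam : YoungDiagram} (h : lam.cells = ∅) :
    schurEval x n lam = 1 := by
  have hmem : ∀ {i j}, (i, j) ∉ lam := fun {i j} hc => by
    rw [← YoungDiagram.mem_cells, h] at hc
    exact notMem_empty _ hc
  have : Subsingleton (BoundedSSYT n lam) := ⟨fun T U =>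
    Subtype.ext (SemistandardYoungTableau.ext fun i j => by rw [T.1.zeros hmem, U.1.zeros hmem])⟩
  let T : BoundedSSYT n lam :=
    ⟨SemistandardYoungTableau.highestWeight lam, fun x hx => by simp [h] at hx⟩
  rw [schurEval, Fintype.sum_subsingleton _ T]
  simp [h]

theorem alternant_betaNumber (x : ℕ → R) (n : ℕ) (lam : YoungDiagram) (hn : lam.colLen 0 ≤ n) :
    alternant x (fun i : Fin n => lam.betaNumber n i) =
      (∏ k ∈ range n, ∏ j ∈ range k, (x j - x k)) * schurEval x n lam := by
  induction n generalizing lam with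
  | zero =>
    have h : lam.cells = ∅ := by
      refine eq_empty_of_forall_notMem fun c hc => ?_
      have := YoungDiagram.mem_iff_lt_colLen.1
        (lam.up_left_mem (Nat.zero_le c.1) (Nat.zero_le c.2) ((lam.mem_cells c).1 hc))
      omega
    rw [schurEval_eq_one x 0 h]
    simp [alternant]
  | succ n ih =>
    rw [alternant_succ x _ fun i => (lam.betaNumber_lt (i := i) (k := i + 1) (Nat.lt_succ_self _)
      (Nat.succ_lt_succ i.2)).le, schurEval_succ x hn, prod_range_succ, mul_comm (∏ k ∈ range n, _),
      mul_assoc, Fin.prod_univ_eq_prod_range (fun j => x j - x n) n]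
    congr 1
    rw [mul_sum]
    symm
    -- The shift by `n - 1 - i` turns `lam_{i+1} ≤ m_i ≤ lam_i` into the half-open interval of
    -- `alternant_succ`, because consecutive beta numbers carry shifts differing by one.
    refine sum_bij' (fun m _ i => m i + (n - 1 - i)) (fun m _ i => m i - (n - 1 - i)) ?_ ?_ ?_ ?_ ?_
    · intro m hm
      rw [Fintype.mem_piFinset]
      intro i
      have := YoungDiagram.mem_interlacing.1 hm i
      simp only [YoungDiagram.betaNumber, mem_Ico, Fin.val_succ, Fin.val_castSucc]
      omega
    · intro m hm
      rw [YoungDiagram.mem_interlacing]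
      intro i
      have := Fintype.mem_piFinset.1 hm i
      simp only [YoungDiagram.betaNumber, mem_Ico, Fin.val_succ, Fin.val_castSucc] at this
      omega
    · intro m _
      simp
    · intro m hm
      funext i
      have := Fintype.mem_piFinset.1 hm i
      simp only [YoungDiagram.betaNumber, mem_Ico, Fin.val_succ, Fin.val_castSucc] at this
      dsimp only
      omega
    · intro m hm
      have h1 := ih (YoungDiagram.ofRows m) (YoungDiagram.colLen_ofRows hm)
      simp only [YoungDiagram.betaNumber, YoungDiagram.rowLen_ofRows hm] at h1
      rw [h1, mul_left_comm]
      congr 2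
      · simp [YoungDiagram.betaNumber]
      · refine prod_congr rfl fun i _ => ?_
        congr 1
        simp only [YoungDiagram.betaNumber, Fin.val_castSucc]
        omega

end Bialternant

/-! ### The hook-content formula over a field. -/

theorem schurSpecialization_eq_schurEval {R : Type*} [CommRing R] (n : ℕ) (lam : YoungDiagram)
    (a b : R) :
    schurSpecialization n lam a b = schurEval (fun j => a ^ (n - 1 - j) * b ^ j) n lam := by
  rw [schurSpecialization, schurPoly, schurEval, map_sum]
  refine sum_congr rfl fun T _ => ?_
  rw [map_prod, ← prod_coe_sort lam.cells]
  simp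

theorem map_schurSpecialization {R S : Type*} [CommRing R] [CommRing S] (φ : R →+* S) (n : ℕ)
    (lam : YoungDiagram) (a b : R) :
    φ (schurSpecialization n lam a b) = schurSpecialization n lam (φ a) (φ b) := by
  simp [schurSpecialization_eq_schurEval, schurEval]

namespace YoungDiagram

variable (lam : YoungDiagram)

theorem partitionB_eq {n : ℕ} (hn : lam.colLen 0 ≤ n) :
    partitionB lam = ∑ i ∈ range n, i * lam.rowLen i := by
  refine sum_subset (range_subset_range.2 hn) fun i _ hi => ?_
  rw [lam.rowLen_eq_zero (not_lt.1 (mt mem_range.2 hi)), mul_zero]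

end YoungDiagram

theorem schurSpecialization_eq_hookContentQuotient {K : Type*} [Field K] {n : ℕ}
    {lam : YoungDiagram} (hn : lam.colLen 0 ≤ n) {a b : K} (ha : a ≠ 0) (hb : b ≠ 0)
    (hab : ∀ m, 0 < m → a ^ m - b ^ m ≠ 0) :
    schurSpecialization n lam a b = hookContentQuotient n lam (a + b) (-(a * b)) := by
  set f : ℕ → K := fun m => a ^ m - b ^ m with hf
  set x : ℕ → K := fun j => a ^ (n - 1 - j) * b ^ j with hx
  set V : K := ∏ k ∈ range n, ∏ j ∈ range k, (x j - x k) with hV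
  have hsub : a - b ≠ 0 := by simpa using hab 1 one_pos
  have hQ : hookContentQuotient n lam (a + b) (-(a * b)) = (a * b) ^ partitionB lam *
      ∏ c ∈ lam.cells, f ((n : ℤ) + cellContent c).toNat / f (hookLength lam c) := by
    rw [hookContentQuotient, neg_neg]
    congr 1
    refine prod_congr rfl fun c _ => ?_
    simp only [hf]
    rw [← genFib_mul_sub, ← genFib_mul_sub, mul_div_mul_right _ _ hsub]
  have key : ∀ mu : YoungDiagram, mu.colLen 0 ≤ n → V * schurEval x n mu =
      (a * b) ^ (∑ k ∈ range n, k * mu.betaNumber n k) *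
        ∏ i ∈ range n, ∏ k ∈ Ioo i n, f (mu.betaNumber n i - mu.betaNumber n k) := fun mu hmu => by
    rw [← alternant_betaNumber x n mu hmu]
    exact alternant_geometric_of_anti a b _ fun i k hik hk => (mu.betaNumber_lt hik hk).le
  have hbot : ∀ i, (⊥ : YoungDiagram).rowLen i = 0 := fun i => by
    by_contra h
    exact YoungDiagram.notMem_bot _ (YoungDiagram.mem_iff_lt_rowLen.2 (Nat.pos_of_ne_zero h))
  have hbotc : (⊥ : YoungDiagram).colLen 0 ≤ n := by
    by_contra! h
    exact YoungDiagram.notMem_bot _ (YoungDiagram.mem_iff_lt_colLen.2 h)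
  -- The empty diagram has Schur polynomial `1`, so `key` also evaluates the Vandermonde product
  -- `V`.
  have hVeq : V = (a * b) ^ (∑ k ∈ range n, k * (n - 1 - k)) *
      ∏ i ∈ range n, ∏ k ∈ Ioo i n, f (k - i) := by
    have h := key ⊥ hbotc
    rw [schurEval_eq_one x n YoungDiagram.cells_bot, mul_one] at h
    rw [h]
    simp only [YoungDiagram.betaNumber, hbot, zero_add]
    congr 1
    refine prod_congr rfl fun i _ => prod_congr rfl fun k hk => ?_
    rw [mem_Ioo] at hk
    congr 1
    omega
  have hV0 : V ≠ 0 := by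
    rw [hVeq]
    refine mul_ne_zero (pow_ne_zero _ (mul_ne_zero ha hb)) (prod_ne_zero_iff.2 fun i _ =>
      prod_ne_zero_iff.2 fun k hk => hab _ ?_)
    rw [mem_Ioo] at hk
    omega
  refine mul_left_cancel₀ hV0 ?_
  rw [schurSpecialization_eq_schurEval, key lam hn, hQ, ← lam.prod_hookContent f hab hn, hVeq,
    lam.partitionB_eq hn]
  -- The exponent `∑ k * l_k` splits into `partitionB lam` and the exponent already present in `V`.
  simp only [YoungDiagram.betaNumber, mul_add, sum_add_distrib, pow_add]
  ring

section HookContent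

variable {R S : Type*} [CommRing R] [CommRing S]

/-- The numerator of the hook-content quotient. -/
def hookContentNum (n : ℕ) (lam : YoungDiagram) (s t : R) : R :=
  (-t) ^ partitionB lam * ∏ c ∈ lam.cells, genFib s t ((n : ℤ) + cellContent c).toNat

/-- The denominator of the hook-content quotient. -/
def hookContentDenom (lam : YoungDiagram) (s t : R) : R :=
  ∏ c ∈ lam.cells, genFib s t (hookLength lam c)

theorem map_hookContentNum (φ : R →+* S) (n : ℕ) (lam : YoungDiagram) (s t : R) :
    φ (hookContentNum n lam s t) = hookContentNum n lam (φ s) (φ t) := by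
  simp [hookContentNum, map_genFib]

theorem map_hookContentDenom (φ : R →+* S) (lam : YoungDiagram) (s t : R) :
    φ (hookContentDenom lam s t) = hookContentDenom lam (φ s) (φ t) := by
  simp [hookContentDenom, map_genFib]

theorem hookContentQuotient_eq_div {K : Type*} [Field K] (n : ℕ) (lam : YoungDiagram) (s t : K) :
    hookContentQuotient n lam s t = hookContentNum n lam s t / hookContentDenom lam s t := by
  rw [hookContentQuotient, hookContentNum, hookContentDenom, prod_div_distrib, mul_div_assoc]

theorem hookContentDenom_ne_zero [IsDomain R] (lam : YoungDiagram) {a b : R}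
    (hab : ∀ m, 0 < m → a ^ m - b ^ m ≠ 0) :
    hookContentDenom lam (a + b) (-(a * b)) ≠ 0 := by
  refine prod_ne_zero_iff.2 fun c hc h => hab (hookLength lam c) ?_ ?_
  · rw [YoungDiagram.mem_cells, YoungDiagram.mem_iff_lt_rowLen] at hc
    rw [lam.hookLength_eq hc]
    omega
  · rw [← genFib_mul_sub, h, zero_mul]

end HookContent

/-! ### Polynomiality of the quotient in `s` and `t`. -/

section IntPoly2

open MvPolynomial

theorem X_pow_sub_X_pow_ne_zero {m : ℕ} (hm : 0 < m) :
    (X 0 ^ m - X 1 ^ m : IntPoly2) ≠ 0 := by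
  intro h
  have := congrArg (MvPolynomial.eval ![(1 : ℤ), 0]) h
  simp [hm.ne'] at this

theorem ratVar_pow_sub_pow_ne_zero {i k : Fin 2} (hik : i ≠ k) {m : ℕ} (hm : 0 < m) :
    ratVar i ^ m - ratVar k ^ m ≠ 0 := by
  have h0 : ratVar 0 ^ m - ratVar 1 ^ m ≠ 0 := by
    rw [ratVar, ratVar, ← map_pow, ← map_pow, ← map_sub]
    exact (map_ne_zero_iff _ (IsFractionRing.injective IntPoly2 RatFun2)).2
      (X_pow_sub_X_pow_ne_zero hm)
  fin_cases i <;> fin_cases k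
  · exact absurd rfl hik
  · exact h0
  · rw [← neg_sub]
    exact neg_ne_zero.2 h0
  · exact absurd rfl hik

theorem ratVar_ne_zero (i : Fin 2) : ratVar i ≠ 0 :=
  (map_ne_zero_iff _ (IsFractionRing.injective IntPoly2 RatFun2)).2 (X_ne_zero i)

theorem schurSpecialization_ratVar {n : ℕ} {lam : YoungDiagram} (hn : lam.colLen 0 ≤ n)
    {i k : Fin 2} (hik : i ≠ k) :
    schurSpecialization n lam (ratVar i) (ratVar k) =
      hookContentQuotient n lam (ratVar i + ratVar k) (-(ratVar i * ratVar k)) :=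
  schurSpecialization_eq_hookContentQuotient hn (ratVar_ne_zero i) (ratVar_ne_zero k)
    fun _ => ratVar_pow_sub_pow_ne_zero hik

/-- The hook-content formula sees `a`, `b` only through `a + b` and `a * b`. -/
theorem schurSpecialization_swap {n : ℕ} {lam : YoungDiagram} (hn : lam.colLen 0 ≤ n) :
    schurSpecialization n lam (X 1 : IntPoly2) (X 0) = schurSpecialization n lam (X 0) (X 1) := by
  refine IsFractionRing.injective IntPoly2 RatFun2 ?_
  rw [map_schurSpecialization, map_schurSpecialization]
  change schurSpecialization n lam (ratVar 1) (ratVar 0) =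
    schurSpecialization n lam (ratVar 0) (ratVar 1)
  rw [schurSpecialization_ratVar hn one_ne_zero, schurSpecialization_ratVar hn zero_ne_one,
    add_comm, mul_comm]

theorem isSymmetric_schurSpecialization {n : ℕ} {lam : YoungDiagram} (hn : lam.colLen 0 ≤ n) :
    (schurSpecialization n lam (X 0 : IntPoly2) (X 1)).IsSymmetric := by
  intro e
  have h := map_schurSpecialization (rename e : IntPoly2 →ₐ[ℤ] IntPoly2).toRingHom n lam
    (X 0) (X 1)
  simp only [AlgHom.toRingHom_eq_coe, RingHom.coe_coe, rename_X] at h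
  rw [h]
  have he : e 0 ≠ e 1 := fun h => zero_ne_one (e.injective h)
  generalize e 0 = i at he ⊢
  generalize e 1 = k at he ⊢
  fin_cases i <;> fin_cases k
  · exact absurd rfl he
  · rfl
  · exact schurSpecialization_swap hn
  · exact absurd rfl he

/-- The substitution `s = a + b`, `t = -ab`. -/
noncomputable def substFib : IntPoly2 →ₐ[ℤ] IntPoly2 := aeval ![X 0 + X 1, -(X 0 * X 1)]

/-- The substitution `t ↦ -t`. -/
noncomputable def negSnd : IntPoly2 →ₐ[ℤ] IntPoly2 := aeval ![X 0, -(X 1)]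

theorem negSnd_negSnd (p : IntPoly2) : negSnd (negSnd p) = p := by
  have : negSnd.comp negSnd = AlgHom.id ℤ IntPoly2 := by
    refine algHom_ext fun i => ?_
    fin_cases i <;> simp [negSnd]
  exact DFunLike.congr_fun this p

/-- Up to the sign of `t`, the substitution is evaluation at the elementary symmetric polynomials,
so the fundamental theorem on symmetric polynomials gives its injectivity and its image. -/
theorem substFib_negSnd (p : IntPoly2) : substFib (negSnd p) = esymmAlgHom (Fin 2) ℤ 2 p := by
  have h2 : esymm (Fin 2) ℤ 2 = X 0 * X 1 := by
    have : powersetCard 2 (univ : Finset (Fin 2)) = {univ} := rfl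
    rw [esymm, this, sum_singleton, Fin.prod_univ_two]
  have h1 : esymm (Fin 2) ℤ 1 = X 0 + X 1 := by rw [esymm_one, Fin.sum_univ_two]
  have : substFib.comp negSnd = (Subalgebra.val _).comp (esymmAlgHom (Fin 2) ℤ 2) := by
    refine algHom_ext fun i => ?_
    fin_cases i <;> simp [negSnd, substFib, esymmAlgHom_apply, h1, h2]
  exact DFunLike.congr_fun this p

theorem substFib_injective : Function.Injective substFib := by
  intro p q h
  rw [← negSnd_negSnd p, ← negSnd_negSnd q, substFib_negSnd, substFib_negSnd] at h
  have := esymmAlgHom_fin_injective ℤ le_rfl (Subtype.ext h)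
  rw [← negSnd_negSnd p, this, negSnd_negSnd]

theorem exists_substFib_eq {p : IntPoly2} (hp : p.IsSymmetric) : ∃ P, substFib P = p := by
  obtain ⟨q, hq⟩ := esymmAlgHom_fin_surjective ℤ (le_refl 2) ⟨p, hp⟩
  exact ⟨negSnd q, by rw [substFib_negSnd, hq]⟩

theorem algebraMap_substFib_generators :
    algebraMap IntPoly2 RatFun2 (substFib (X 0)) = ratVar 0 + ratVar 1 ∧
      algebraMap IntPoly2 RatFun2 (substFib (X 1)) = -(ratVar 0 * ratVar 1) := by
  simp [substFib, ratVar]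

theorem algebraMap_eq_hookContentQuotient {n : ℕ} {lam : YoungDiagram} (hn : lam.colLen 0 ≤ n)
    {P : IntPoly2} (hP : substFib P = schurSpecialization n lam (X 0) (X 1)) :
    algebraMap IntPoly2 RatFun2 P = hookContentQuotient n lam (ratVar 0) (ratVar 1) := by
  have hinj := IsFractionRing.injective IntPoly2 RatFun2
  let ψ : IntPoly2 →+* RatFun2 := (algebraMap IntPoly2 RatFun2).comp substFib.toRingHom
  have hψ : Function.Injective ψ := hinj.comp substFib_injective
  have hψ0 : ψ (X 0) = ratVar 0 + ratVar 1 := algebraMap_substFib_generators.1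
  have hψ1 : ψ (X 1) = -(ratVar 0 * ratVar 1) := algebraMap_substFib_generators.2
  have hψP : ψ P = schurSpecialization n lam (ratVar 0) (ratVar 1) :=
    (congrArg (algebraMap IntPoly2 RatFun2) hP).trans (map_schurSpecialization _ _ _ _ _)
  have hD : ψ (hookContentDenom lam (X 0) (X 1)) ≠ 0 := by
    rw [map_hookContentDenom, hψ0, hψ1]
    exact hookContentDenom_ne_zero lam fun _ => ratVar_pow_sub_pow_ne_zero zero_ne_one
  -- A substitution need not extend to all fractions, so denominators are cleared first and the
  -- polynomial identity is checked after the injective map `ψ`.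
  have hmul : P * hookContentDenom lam (X 0) (X 1) = hookContentNum n lam (X 0) (X 1) := by
    refine hψ ?_
    rw [map_mul, hψP, schurSpecialization_ratVar hn zero_ne_one, hookContentQuotient_eq_div,
      ← hψ0, ← hψ1, ← map_hookContentDenom, div_mul_cancel₀ _ hD, map_hookContentNum]
  rw [hookContentQuotient_eq_div, ratVar, ratVar, ← map_hookContentNum, ← map_hookContentDenom,
    eq_div_iff, ← map_mul, hmul]
  exact (map_ne_zero_iff _ hinj).2 fun h => hD (by rw [h, map_zero])

end IntPoly2

/-- For a partition `lam` of `k` with at most `n` parts, the hook-content identity holds in the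
field of rational functions in the indeterminates `a = ratVar 0`, `b = ratVar 1`.  Moreover, as a
rational function of the indeterminates `s = ratVar 0`, `t = ratVar 1`, the hook-content quotient is
an integer polynomial `P(s, t)`, and `P(a + b, -ab)` is the specialized Schur polynomial
in `ℤ[a, b]`. -/
theorem mainTheorem7 (n k : ℕ) (lam : YoungDiagram) (hcard : lam.card = k)
    (hrows : lam.colLen 0 ≤ n) :
    schurSpecialization n lam (ratVar 0) (ratVar 1) =
        hookContentQuotient n lam (ratVar 0 + ratVar 1) (-(ratVar 0 * ratVar 1)) ∧
      ∃ P : IntPoly2,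
        algebraMap IntPoly2 RatFun2 P = hookContentQuotient n lam (ratVar 0) (ratVar 1) ∧
        MvPolynomial.aeval
            ![(MvPolynomial.X 0 + MvPolynomial.X 1 : IntPoly2),
              -(MvPolynomial.X 0 * MvPolynomial.X 1)] P =
          schurSpecialization n lam (MvPolynomial.X 0 : IntPoly2) (MvPolynomial.X 1) := by
  refine ⟨schurSpecialization_ratVar hrows zero_ne_one, ?_⟩
  obtain ⟨P, hP⟩ := exists_substFib_eq (isSymmetric_schurSpecialization hrows)
  exact ⟨P, algebraMap_eq_hookContentQuotient hrows hP, hP⟩
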